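/- Theorem. Let $V$ be a real vector space of dimension $m\ge 4$. View $\otimes^2V^*\otimes\operatorname{End}(V)$ as the space of operator-valued bilinear forms $\mathcal R:(x,y)\mapsto\mathcal R(x,y)\in\operatorname{End}(V)$ and $\otimes^2V^*$ as the space of bilinear forms on $V$, with the natural actions of $GL(V)$, namely $(g\cdot\mathcal R)(x,y)z=g\,\mathcal R(g^{-1}x,g^{-1}y)g^{-1}z$ and $(g\cdot\psi)(x,y)=\psi(g^{-1}x,g^{-1}y)$. Put $$\rho_{14}(\mathcal R)(x,y)=\operatorname{Tr}\{z\mapsto\mathcal R(z,x)y\},\qquad \rho_{34}(\mathcal R)(x,y)=\operatorname{Tr}\{z\mapsto\mathcal R(x,y)z\},$$ and let $\Lambda^2(V^*)$ and $S^2(V^*)$ be the spaces of alternating and of symmetric bilinear forms on $V$, with the projections $\pi_a(\psi)(x,y)=\frac12(\psi(x,y)-\psi(y,x))$ and $\pi_s(\psi)(x,y)=\frac12(\psi(x,y)+\psi(y,x))$ of $\otimes^2V^*$. Let - $\mathfrak R(V)$ be the space of all $\mathcal R$ with $\mathcal R(x,y)z=-\mathcal R(y,x)z$ and $\mathcal R(x,y)z+\mathcal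 R(y,z)x+\mathcal R(z,x)y=0$ for all $x,y,z\in V$; - $\mathfrak F(V)$ be the space of all $\mathcal F\in\mathfrak R(V)$ such that $\rho_{14}(\mathcal F)$ is symmetric and $\rho_{34}(\mathcal F)=0$; - $\mathfrak U(V)=\ker(\rho_{14})\cap\mathfrak R(V)$. These are $GL(V)$-invariant subspaces. There are $GL(V)$-equivariant short exact sequences $$0\to\mathfrak F(V)\to\mathfrak R(V)\xrightarrow{\ \pi_a\circ\rho_{14}\ }\Lambda^2(V^*)\to0,\qquad 0\to\mathfrak U(V)\to\mathfrak F(V)\xrightarrow{\ \pi_s\circ\rho_{14}\ }S^2(V^*)\to0,$$ whose first maps are the inclusions, and which are equivariantly split, respectively, by the maps $$\sigma_a(\omega)(x,y)z=\tfrac{-1}{1+m}\{2\omega(x,y)z+\omega(x,z)y-\omega(y,z)x\}\quad(\omega\in\Lambda^2(V^*)),$$ $$\sigma_s(\psi)(x,y)z=\tfrac{1}{1-m}\{\psi(x,z)y-\psi(y,z)x\}\quad(\psi\in S^2(V^*)).$$ Consequently $(\mathcal U,\psi)\mapsto\mathcal U+\sigma_s(\psi)$ is a $GL(V)$-equivariant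 isomorphism $\mathfrak U(V)\oplus S^2(V^*)\cong\mathfrak F(V)$, in which $\mathfrak U(V)$ and $S^2(V^*)$ are irreducible $GL(V)$-modules, and $$\dim\mathfrak U(V)=\frac{m^2(m^2-4)}3,\qquad\dim S^2(V^*)=\frac{m(m+1)}2,\qquad\dim\mathfrak F(V)=\frac{m(m-1)(2m^2+2m-3)}6.$$ -/

import Mathlib

noncomputable section

namespace AffineCurvature

open Module

variable (V : Type*) [AddCommGroup V] [Module ℝ V]

/-- `GL(V)`. -/
abbrev GLV := LinearMap.GeneralLinearGroup ℝ V

/-- `V* ⊗ V* ⊗ End(V)`: operator-valued bilinear forms, `𝓡 x y z` being `𝓡(x,y)z`. -/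
abbrev OpForm := V →ₗ[ℝ] V →ₗ[ℝ] V →ₗ[ℝ] V

/-- `V* ⊗ V*`: bilinear forms on `V`. -/
abbrev BilForm := V →ₗ[ℝ] V →ₗ[ℝ] ℝ

/-- The defining representation of `GL(V)` on `V`. -/
def stdRep : Representation ℝ (GLV V) V := Units.coeHom (Module.End ℝ V)

/-- The natural action of `GL(V)` on operator-valued bilinear forms:
`(g • 𝓡)(x,y)z = g (𝓡(g⁻¹ x, g⁻¹ y) g⁻¹ z)`. -/
def opRep : Representation ℝ (GLV V) (OpForm V) :=
  (stdRep V).linHom ((stdRep V).linHom ((stdRep V).linHom (stdRep V)))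

/-- The natural action of `GL(V)` on bilinear forms: `(g • ψ)(x,y) = ψ(g⁻¹ x, g⁻¹ y)`. -/
def bilRep : Representation ℝ (GLV V) (BilForm V) :=
  (stdRep V).linHom ((stdRep V).linHom (Representation.trivial ℝ (GLV V) ℝ))

variable {V}

@[simp] theorem opRep_apply (g : GLV V) (R : OpForm V) (x y z : V) :
    opRep V g R x y z = g.1 (R (g⁻¹.1 x) (g⁻¹.1 y) (g⁻¹.1 z)) := rfl

@[simp] theorem bilRep_apply (g : GLV V) (ψ : BilForm V) (x y : V) :
    bilRep V g ψ x y = ψ (g⁻¹.1 x) (g⁻¹.1 y) := rfl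

/-- `ρ₁₄(𝓡)(x,y) = Tr {z ↦ 𝓡(z,x)y}`. -/
def rho14 : OpForm V →ₗ[ℝ] BilForm V where
  toFun R := LinearMap.mk₂ ℝ (fun x y => LinearMap.trace ℝ V ((R.flip x).flip y))
    (fun x x' y => by rw [← map_add]; congr 1; ext z; simp)
    (fun c x y => by rw [← map_smul]; congr 1; ext z; simp)
    (fun x y y' => by rw [← map_add]; congr 1; ext z; simp)
    (fun c x y => by rw [← map_smul]; congr 1; ext z; simp)
  map_add' R S := by
    ext x y
    simp only [LinearMap.mk₂_apply, LinearMap.add_apply]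
    rw [← map_add]; congr 1
  map_smul' c R := by
    ext x y
    simp only [LinearMap.mk₂_apply, LinearMap.smul_apply, RingHom.id_apply]
    rw [← map_smul]; congr 1

/-- `ρ₃₄(𝓡)(x,y) = Tr {z ↦ 𝓡(x,y)z}`. -/
def rho34 : OpForm V →ₗ[ℝ] BilForm V where
  toFun R := R.compr₂ (LinearMap.trace ℝ V)
  map_add' R S := by ext x y; simp
  map_smul' c R := by ext x y; simp

theorem rho14_apply (R : OpForm V) (x y : V) :
    rho14 R x y = LinearMap.trace ℝ V
      { toFun := fun z => R z x y, map_add' := by simp, map_smul' := by simp } := rfl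

theorem rho34_apply (R : OpForm V) (x y : V) :
    rho34 R x y = LinearMap.trace ℝ V
      { toFun := fun z => R x y z, map_add' := by simp, map_smul' := by simp } := rfl

/-- `π_a(ψ)(x,y) = ½ (ψ(x,y) - ψ(y,x))`. -/
def piA : BilForm V →ₗ[ℝ] BilForm V where
  toFun ψ := (1 / 2 : ℝ) • (ψ - ψ.flip)
  map_add' φ ψ := by ext x y; simp; ring
  map_smul' c ψ := by ext x y; simp; ring

/-- `π_s(ψ)(x,y) = ½ (ψ(x,y) + ψ(y,x))`. -/
def piS : BilForm V →ₗ[ℝ] BilForm V where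
  toFun ψ := (1 / 2 : ℝ) • (ψ + ψ.flip)
  map_add' φ ψ := by ext x y; simp; ring
  map_smul' c ψ := by ext x y; simp; ring

theorem piA_apply (ψ : BilForm V) (x y : V) : piA ψ x y = (1 / 2 : ℝ) * (ψ x y - ψ y x) := rfl

theorem piS_apply (ψ : BilForm V) (x y : V) : piS ψ x y = (1 / 2 : ℝ) * (ψ x y + ψ y x) := rfl

/-- `σ_a(ω)(x,y)z = -1/(1+m) * (2 ω(x,y) z + ω(x,z) y - ω(y,z) x)` with `m = dim V`. -/
def sigmaA (ω : BilForm V) : OpForm V :=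
  LinearMap.mk₂ ℝ (fun x y =>
    { toFun := fun z => (-1 / (1 + (finrank ℝ V : ℝ))) •
        ((2 * ω x y) • z + ω x z • y - ω y z • x)
      map_add' := fun z z' => by simp only [map_add]; module
      map_smul' := fun c z => by
        simp only [map_smul, smul_eq_mul, RingHom.id_apply]; module })
    (fun x x' y => by ext z; simp; module)
    (fun c x y => by ext z; simp; module)
    (fun x y y' => by ext z; simp; module)
    (fun c x y => by ext z; simp; module)

/-- `σ_s(ψ)(x,y)z = 1/(1-m) * (ψ(x,z) y - ψ(y,z) x)` with `m = dim V`. -/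
def sigmaS (ψ : BilForm V) : OpForm V :=
  LinearMap.mk₂ ℝ (fun x y =>
    { toFun := fun z => (1 / (1 - (finrank ℝ V : ℝ))) • (ψ x z • y - ψ y z • x)
      map_add' := fun z z' => by simp only [map_add]; module
      map_smul' := fun c z => by
        simp only [map_smul, smul_eq_mul, RingHom.id_apply]; module })
    (fun x x' y => by ext z; simp; module)
    (fun c x y => by ext z; simp; module)
    (fun x y y' => by ext z; simp; module)
    (fun c x y => by ext z; simp; module)

theorem sigmaA_apply (ω : BilForm V) (x y z : V) :
    sigmaA ω x y z = (-1 / (1 + (finrank ℝ V : ℝ))) •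
      ((2 * ω x y) • z + ω x z • y - ω y z • x) := rfl

theorem sigmaS_apply (ψ : BilForm V) (x y z : V) :
    sigmaS ψ x y z = (1 / (1 - (finrank ℝ V : ℝ))) • (ψ x z • y - ψ y z • x) := rfl

theorem trace_conj_gl (g : GLV V) (f : V →ₗ[ℝ] V) :
    LinearMap.trace ℝ V (g.1 ∘ₗ f ∘ₗ g⁻¹.1) = LinearMap.trace ℝ V f := by
  have h := LinearMap.trace_mul_comm ℝ (M := V) g.1 (f * g⁻¹.1)
  have h2 : f * g⁻¹.1 * g.1 = f := by rw [mul_assoc, Units.inv_mul, mul_one]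
  rw [h2] at h
  exact h

theorem rho14_opRep (g : GLV V) (R : OpForm V) : rho14 (opRep V g R) = bilRep V g (rho14 R) := by
  ext x y
  rw [bilRep_apply, rho14_apply R, ← trace_conj_gl g]
  rfl

theorem rho34_opRep (g : GLV V) (R : OpForm V) : rho34 (opRep V g R) = bilRep V g (rho34 R) := by
  ext x y
  rw [bilRep_apply, rho34_apply R, ← trace_conj_gl g]
  rfl

variable (V)

/-- The additive group structure on a subspace of bilinear forms, which type class search does not
find by itself. -/
instance instBilGroup (S : Submodule ℝ (BilForm V)) : AddCommGroup S :=
  Submodule.addCommGroup (R := ℝ) (M := BilForm V) S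

/-- The additive group structure on a subspace of operator-valued bilinear forms. -/
instance instOpGroup (S : Submodule ℝ (OpForm V)) : AddCommGroup S :=
  Submodule.addCommGroup (R := ℝ) (M := OpForm V) S

/-- The space `Λ²(V*)` of alternating bilinear forms. -/
def altSubmodule : Submodule ℝ (BilForm V) where
  carrier := {ω | ∀ x y, ω x y = -ω y x}
  add_mem' {a b} ha hb x y := by
    simp only [LinearMap.add_apply, ha x y, hb x y]; ring
  zero_mem' x y := by simp
  smul_mem' c a ha x y := by
    simp only [LinearMap.smul_apply, ha x y, smul_neg]

/-- The space `S²(V*)` of symmetric bilinear forms. -/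
def symSubmodule : Submodule ℝ (BilForm V) where
  carrier := {ψ | ∀ x y, ψ x y = ψ y x}
  add_mem' {a b} ha hb x y := by
    simp only [LinearMap.add_apply, ha x y, hb x y]
  zero_mem' x y := by simp
  smul_mem' c a ha x y := by
    simp only [LinearMap.smul_apply, ha x y]

/-- The space `ℜ(V)` of curvature operators: the operator-valued bilinear forms that are
skew-symmetric and satisfy the first Bianchi identity. -/
def curvSubmodule : Submodule ℝ (OpForm V) where
  carrier := {R | (∀ x y z, R x y z = -R y x z) ∧ ∀ x y z, R x y z + R y z x + R z x y = 0}
  add_mem' {a b} ha hb := by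
    refine ⟨fun x y z => ?_, fun x y z => ?_⟩
    · simp only [LinearMap.add_apply, ha.1 x y z, hb.1 x y z]; abel
    · have h := congrArg₂ (· + ·) (ha.2 x y z) (hb.2 x y z)
      simp only [add_zero] at h
      simp only [LinearMap.add_apply]
      rw [← h]; abel
  zero_mem' := by simp
  smul_mem' c a ha := by
    refine ⟨fun x y z => ?_, fun x y z => ?_⟩
    · simp only [LinearMap.smul_apply, ha.1 x y z, smul_neg]
    · simp only [LinearMap.smul_apply, ← smul_add, ha.2 x y z, smul_zero]

/-- The space `𝔉(V)` of affine curvature operators: the curvature operators `𝓕` with `ρ₁₄(𝓕)`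
symmetric and `ρ₃₄(𝓕) = 0`. -/
def affSubmodule : Submodule ℝ (OpForm V) where
  carrier := {F | (∀ x y z, F x y z = -F y x z) ∧ (∀ x y z, F x y z + F y z x + F z x y = 0) ∧
    (∀ x y, rho14 F x y = rho14 F y x) ∧ rho34 F = 0}
  add_mem' {a b} ha hb := by
    obtain ⟨h1, h2⟩ := (curvSubmodule V).add_mem (x := a) (y := b) ⟨ha.1, ha.2.1⟩ ⟨hb.1, hb.2.1⟩
    refine ⟨h1, h2, fun x y => ?_, ?_⟩
    · simp only [map_add, LinearMap.add_apply, ha.2.2.1 x y, hb.2.2.1 x y]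
    · rw [map_add, ha.2.2.2, hb.2.2.2, add_zero]
  zero_mem' := by simp
  smul_mem' c a ha := by
    obtain ⟨h1, h2⟩ := (curvSubmodule V).smul_mem (x := a) c ⟨ha.1, ha.2.1⟩
    refine ⟨h1, h2, fun x y => ?_, ?_⟩
    · simp only [map_smul, LinearMap.smul_apply, ha.2.2.1 x y]
    · rw [map_smul, ha.2.2.2, smul_zero]

/-- `Λ²(V*)` as a `GL(V)`-module. -/
def Alt2 : Subrepresentation (bilRep V) where
  toSubmodule := altSubmodule V
  apply_mem_toSubmodule g a ha x y := by
    simp only [bilRep_apply]; exact ha _ _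

/-- `S²(V*)` as a `GL(V)`-module. -/
def SymB : Subrepresentation (bilRep V) where
  toSubmodule := symSubmodule V
  apply_mem_toSubmodule g a ha x y := by
    simp only [bilRep_apply]; exact ha _ _

theorem opRep_mem_curv (g : GLV V) {a : OpForm V} (ha : a ∈ curvSubmodule V) :
    opRep V g a ∈ curvSubmodule V := by
  refine ⟨fun x y z => ?_, fun x y z => ?_⟩
  · simp only [opRep_apply]; rw [ha.1, map_neg]
  · simp only [opRep_apply, ← map_add, ha.2, map_zero]

/-- `ℜ(V)` as a `GL(V)`-module. -/
def CurvR : Subrepresentation (opRep V) where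
  toSubmodule := curvSubmodule V
  apply_mem_toSubmodule g _ ha := opRep_mem_curv V g ha

/-- `𝔉(V)` as a `GL(V)`-module. -/
def AffF : Subrepresentation (opRep V) where
  toSubmodule := affSubmodule V
  apply_mem_toSubmodule g a ha := by
    obtain ⟨h1, h2⟩ := opRep_mem_curv V g (a := a) ⟨ha.1, ha.2.1⟩
    refine ⟨h1, h2, fun x y => ?_, ?_⟩
    · rw [rho14_opRep, bilRep_apply, bilRep_apply, ha.2.2.1]
    · rw [rho34_opRep, ha.2.2.2, map_zero]

/-- `𝔘(V) = ker ρ₁₄ ∩ ℜ(V)` as a `GL(V)`-module. -/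
def ProjU : Subrepresentation (opRep V) where
  toSubmodule := LinearMap.ker rho14 ⊓ curvSubmodule V
  apply_mem_toSubmodule g a ha := by
    refine ⟨?_, opRep_mem_curv V g ha.2⟩
    have h : rho14 a = 0 := ha.1
    change rho14 (opRep V g a) = 0
    rw [rho14_opRep, h, map_zero]

variable {V}

/-- `0 → A --i--> B --p--> C → 0` is a short exact sequence of representations, split by the
equivariant map `s`. -/
structure IsSplitShortExact {G A B C : Type*} [Group G] [AddCommGroup A] [Module ℝ A]
    [AddCommGroup B] [Module ℝ B] [AddCommGroup C] [Module ℝ C]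
    {α : Representation ℝ G A} {β : Representation ℝ G B} {γ : Representation ℝ G C}
    (i : α.IntertwiningMap β) (p : β.IntertwiningMap γ) (s : γ.IntertwiningMap β) : Prop where
  injective : Function.Injective i
  exact : Function.Exact i p
  surjective : Function.Surjective p
  split : ∀ c, p (s c) = c

end AffineCurvature

end

/-!
Contracting with `ρ₁₄` turns `σ_a` and `σ_s` into explicit sections, which splits both sequences,
and the Bianchi identity gives `ρ₃₄(R)(x, y) = ρ₁₄(R)(y, x) - ρ₁₄(R)(x, y)`, so `𝔉(V)` is the kernel
of `π_a ∘ ρ₁₄`. A curvature operator is freely determined by its values at the basis triples that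
are semistandard of shape `(2,1)`, which yields the dimension of `ℜ(V)` and hence all others.

For irreducibility, let `N` be a nonzero invariant subspace of `𝔘(V)`. A Ricci-flat `R` with
`R(x,y)x ∈ span {x, y}` for all `x, y` vanishes: it would have the form `σ_a(ω)`, and then
`ω = ρ₁₄(R) = 0`. So `N` contains an operator with `R(x,y)x ∉ span {x, y}` for some `x, y`, and
projecting it to a weight space of a diagonal one-parameter group shows that `N` contains the
highest weight vector. Pairing an operator `R` with the orbit of that vector reads off the numbers
`ξ(R(x,y)x)` for linear forms `ξ` that vanish at `x` and `y`. These vanish only for `R = 0`, hence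
the orbit spans `𝔘(V)` and `N = 𝔘(V)`. For `S²(V*)`, powers `α ⊗ α` of linear forms and the
values `ψ(x, x)` play the same role.
-/

noncomputable section

namespace AffineCurvature

open Module

section SplitShortExact

variable {G A B C : Type*} [Group G] [AddCommGroup A] [Module ℝ A] [AddCommGroup B] [Module ℝ B]
  [AddCommGroup C] [Module ℝ C] {α : Representation ℝ G A} {β : Representation ℝ G B}
  {γ : Representation ℝ G C} {i : α.IntertwiningMap β} {p : β.IntertwiningMap γ}
  {s : γ.IntertwiningMap β}

theorem IsSplitShortExact.bijective_coprod (h : IsSplitShortExact i p s) :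
    Function.Bijective (i.toLinearMap.coprod s.toLinearMap) := by
  have proj_sum (x : A × C) : p (i x.1 + s x.2) = x.2 := by
    rw [map_add, (h.exact _).2 ⟨x.1, rfl⟩, h.split, zero_add]
  constructor
  · intro x y (hxy : i x.1 + s x.2 = i y.1 + s y.2)
    have h₂ : x.2 = y.2 := by rw [← proj_sum x, ← proj_sum y, hxy]
    rw [h₂] at hxy
    exact Prod.ext (h.injective (add_right_cancel hxy)) h₂
  · intro b
    obtain ⟨a, ha⟩ := (h.exact (b - s (p b))).1 (by rw [map_sub, h.split, sub_self])
    refine ⟨(a, p b), ?_⟩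
    change i a + s (p b) = b
    rw [ha, sub_add_cancel]

/-- The equivariant isomorphism `(a, c) ↦ i a + s c` of a split short exact sequence. -/
def IsSplitShortExact.equiv (h : IsSplitShortExact i p s) : (α.prod γ).Equiv β :=
  .mk (.ofBijective _ h.bijective_coprod) fun g => LinearMap.ext fun x => by
    change i (α g x.1) + s (γ g x.2) = β g (i x.1 + s x.2)
    rw [map_add, i.isIntertwining, s.isIntertwining]

theorem IsSplitShortExact.finrank_eq [FiniteDimensional ℝ B] (h : IsSplitShortExact i p s) :
    finrank ℝ B = finrank ℝ A + finrank ℝ C := by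
  have := Module.Finite.of_injective i.toLinearMap h.injective
  have := Module.Finite.of_surjective p.toLinearMap h.surjective
  rw [← (LinearEquiv.ofBijective _ h.bijective_coprod).finrank_eq, finrank_prod]

end SplitShortExact

section Splittings

variable {V : Type*} [AddCommGroup V] [Module ℝ V]

theorem sigmaA_opRep (g : GLV V) (ω : BilForm V) :
    opRep V g (sigmaA ω) = sigmaA (bilRep V g ω) := by
  have apply_inv (v : V) : g.1 (g⁻¹.1 v) = v := LinearMap.congr_fun g.mul_inv v
  ext x y z
  simp only [opRep_apply, sigmaA_apply, bilRep_apply, map_smul, map_sub, map_add, apply_inv]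

theorem sigmaS_opRep (g : GLV V) (ψ : BilForm V) :
    opRep V g (sigmaS ψ) = sigmaS (bilRep V g ψ) := by
  have apply_inv (v : V) : g.1 (g⁻¹.1 v) = v := LinearMap.congr_fun g.mul_inv v
  ext x y z
  simp only [opRep_apply, sigmaS_apply, bilRep_apply, map_smul, map_sub, apply_inv]

theorem piA_bilRep (g : GLV V) (ψ : BilForm V) : piA (bilRep V g ψ) = bilRep V g (piA ψ) := rfl

theorem piS_bilRep (g : GLV V) (ψ : BilForm V) : piS (bilRep V g ψ) = bilRep V g (piS ψ) := rfl

theorem piA_mem (ψ : BilForm V) : piA ψ ∈ altSubmodule V := fun x y => by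
  simp only [piA_apply]; ring

theorem piS_mem (ψ : BilForm V) : piS ψ ∈ symSubmodule V := fun x y => by
  simp only [piS_apply]; ring

theorem piA_eq_self {ω : BilForm V} (hω : ω ∈ altSubmodule V) : piA ω = ω := by
  ext x y; rw [piA_apply, hω y x]; ring

theorem piS_eq_self {ψ : BilForm V} (hψ : ψ ∈ symSubmodule V) : piS ψ = ψ := by
  ext x y; rw [piS_apply, hψ y x]; ring

theorem piA_eq_zero_iff {ψ : BilForm V} : piA ψ = 0 ↔ ψ ∈ symSubmodule V := by
  refine ⟨fun h x y => ?_, fun h => ?_⟩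
  · have : piA ψ x y = 0 := by rw [h]; rfl
    rw [piA_apply] at this
    linarith
  · ext x y
    rw [piA_apply, h x y, sub_self, mul_zero]; rfl

theorem sigmaA_mem_curv {ω : BilForm V} (hω : ω ∈ altSubmodule V) :
    sigmaA ω ∈ curvSubmodule V := by
  refine ⟨fun x y z => ?_, fun x y z => ?_⟩
  · simp only [sigmaA_apply, hω y x]; module
  · simp only [sigmaA_apply, hω z x, hω z y, hω y x]; module

theorem sigmaS_mem_curv {ψ : BilForm V} (hψ : ψ ∈ symSubmodule V) :
    sigmaS ψ ∈ curvSubmodule V := by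
  refine ⟨fun x y z => ?_, fun x y z => ?_⟩
  · simp only [sigmaS_apply]; module
  · simp only [sigmaS_apply, hψ z x, hψ z y, hψ y x]; module

variable (V) in
/-- `σ_a` as a linear map. -/
def sigmaALin : BilForm V →ₗ[ℝ] OpForm V where
  toFun := sigmaA
  map_add' ω η := by
    ext x y z; simp only [sigmaA_apply, LinearMap.add_apply]; module
  map_smul' c ω := by
    ext x y z
    simp only [sigmaA_apply, LinearMap.smul_apply, smul_eq_mul, RingHom.id_apply]; module

variable (V) in
/-- `σ_s` as a linear map. -/
def sigmaSLin : BilForm V →ₗ[ℝ] OpForm V where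
  toFun := sigmaS
  map_add' φ ψ := by
    ext x y z; simp only [sigmaS_apply, LinearMap.add_apply]; module
  map_smul' c ψ := by
    ext x y z
    simp only [sigmaS_apply, LinearMap.smul_apply, smul_eq_mul, RingHom.id_apply]; module

theorem rho34_eq_of_mem_curv {R : OpForm V} (hR : R ∈ curvSubmodule V) (x y : V) :
    rho34 R x y = rho14 R y x - rho14 R x y := by
  rw [rho14_apply, rho14_apply, rho34_apply, ← map_sub]
  congr 1
  ext z
  have bianchi := hR.2 x y z
  change R x y z = R z y x - R z x y
  rw [hR.1 z y x, ← sub_eq_zero, ← bianchi]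
  abel

theorem mem_aff_iff {R : OpForm V} :
    R ∈ affSubmodule V ↔ R ∈ curvSubmodule V ∧ rho14 R ∈ symSubmodule V := by
  refine ⟨fun h => ⟨⟨h.1, h.2.1⟩, h.2.2.1⟩, fun ⟨h₁, h₂⟩ => ⟨h₁.1, h₁.2, h₂, ?_⟩⟩
  ext x y
  rw [rho34_eq_of_mem_curv h₁, h₂ x y, sub_self, LinearMap.zero_apply, LinearMap.zero_apply]

theorem aff_le_curv : affSubmodule V ≤ curvSubmodule V := fun _ hF => (mem_aff_iff.1 hF).1

theorem mem_projU_iff_of_mem_aff {R : OpForm V} (hR : R ∈ affSubmodule V) :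
    R ∈ (ProjU V).toSubmodule ↔ rho14 R = 0 :=
  ⟨fun h => h.1, fun h => ⟨h, aff_le_curv hR⟩⟩

theorem projU_le_aff : (ProjU V).toSubmodule ≤ affSubmodule V := fun R hR =>
  mem_aff_iff.2 ⟨hR.2, by rw [show rho14 R = 0 from hR.1]; exact zero_mem _⟩

variable [FiniteDimensional ℝ V]

theorem rho14_sigmaA {ω : BilForm V} (hω : ω ∈ altSubmodule V) : rho14 (sigmaA ω) = ω := by
  ext x y
  have endo_eq : ((sigmaA ω).flip x).flip y = (-1 / (1 + (finrank ℝ V : ℝ))) •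
      ((2 : ℝ) • (ω.flip x).smulRight y + (ω.flip y).smulRight x - ω x y • LinearMap.id) := by
    ext z
    change sigmaA ω z x y = (-1 / (1 + (finrank ℝ V : ℝ))) •
      ((2 : ℝ) • ω z x • y + ω z y • x - ω x y • z)
    rw [sigmaA_apply]
    module
  change LinearMap.trace ℝ V (((sigmaA ω).flip x).flip y) = ω x y
  rw [endo_eq]
  simp only [map_smul, map_sub, map_add, LinearMap.trace_smulRight, LinearMap.trace_id,
    LinearMap.flip_apply, smul_eq_mul]
  have : 1 + (finrank ℝ V : ℝ) ≠ 0 := by positivity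
  rw [hω y x]
  field_simp
  ring

theorem rho14_sigmaS (hV : 1 < finrank ℝ V) (ψ : BilForm V) : rho14 (sigmaS ψ) = ψ := by
  ext x y
  have endo_eq : ((sigmaS ψ).flip x).flip y = (1 / (1 - (finrank ℝ V : ℝ))) •
      ((ψ.flip y).smulRight x - ψ x y • LinearMap.id) := rfl
  change LinearMap.trace ℝ V (((sigmaS ψ).flip x).flip y) = ψ x y
  rw [endo_eq]
  simp only [map_smul, map_sub, LinearMap.trace_smulRight, LinearMap.trace_id,
    LinearMap.flip_apply, smul_eq_mul]
  have : (1 : ℝ) - finrank ℝ V ≠ 0 := sub_ne_zero.2 (by exact_mod_cast hV.ne)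
  field_simp

theorem sigmaS_mem_aff (hV : 1 < finrank ℝ V) {ψ : BilForm V} (hψ : ψ ∈ symSubmodule V) :
    sigmaS ψ ∈ affSubmodule V :=
  mem_aff_iff.2 ⟨sigmaS_mem_curv hψ, (rho14_sigmaS hV ψ).symm ▸ hψ⟩

end Splittings

section Sequences

variable (V : Type*) [AddCommGroup V] [Module ℝ V]

/-- The inclusion `𝔉(V) → ℜ(V)`. -/
def inclAffCurv : (AffF V).toRepresentation.IntertwiningMap (CurvR V).toRepresentation where
  toLinearMap := Submodule.inclusion (p := (AffF V).toSubmodule) (p' := (CurvR V).toSubmodule)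
    aff_le_curv
  isIntertwining' _ := rfl

/-- The inclusion `𝔘(V) → 𝔉(V)`. -/
def inclProjUAff : (ProjU V).toRepresentation.IntertwiningMap (AffF V).toRepresentation where
  toLinearMap := Submodule.inclusion (p := (ProjU V).toSubmodule) (p' := (AffF V).toSubmodule)
    projU_le_aff
  isIntertwining' _ := rfl

/-- `π_a ∘ ρ₁₄ : ℜ(V) → Λ²(V*)`. -/
def curvToAlt : (CurvR V).toRepresentation.IntertwiningMap (Alt2 V).toRepresentation where
  toLinearMap := LinearMap.codRestrict (Alt2 V).toSubmodule
    ((piA ∘ₗ rho14) ∘ₗ (CurvR V).toSubmodule.subtype) fun _ => piA_mem _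
  isIntertwining' g := by
    refine LinearMap.ext fun R => Subtype.ext ?_
    change piA (rho14 (opRep V g R.1)) = bilRep V g (piA (rho14 R.1))
    rw [rho14_opRep, piA_bilRep]

/-- `π_s ∘ ρ₁₄ : 𝔉(V) → S²(V*)`. -/
def affToSym : (AffF V).toRepresentation.IntertwiningMap (SymB V).toRepresentation where
  toLinearMap := LinearMap.codRestrict (SymB V).toSubmodule
    ((piS ∘ₗ rho14) ∘ₗ (AffF V).toSubmodule.subtype) fun _ => piS_mem _
  isIntertwining' g := by
    refine LinearMap.ext fun F => Subtype.ext ?_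
    change piS (rho14 (opRep V g F.1)) = bilRep V g (piS (rho14 F.1))
    rw [rho14_opRep, piS_bilRep]

/-- `σ_a : Λ²(V*) → ℜ(V)`. -/
def altToCurv : (Alt2 V).toRepresentation.IntertwiningMap (CurvR V).toRepresentation where
  toLinearMap := LinearMap.codRestrict (CurvR V).toSubmodule
    (sigmaALin V ∘ₗ (Alt2 V).toSubmodule.subtype) fun ω => sigmaA_mem_curv ω.2
  isIntertwining' g := LinearMap.ext fun ω => Subtype.ext (sigmaA_opRep g ω.1).symm

variable [FiniteDimensional ℝ V]

variable {V} in
/-- `σ_s : S²(V*) → 𝔉(V)`. -/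
def symToAff (hV : 1 < finrank ℝ V) :
    (SymB V).toRepresentation.IntertwiningMap (AffF V).toRepresentation where
  toLinearMap := LinearMap.codRestrict (AffF V).toSubmodule
    (sigmaSLin V ∘ₗ (SymB V).toSubmodule.subtype) fun ψ => sigmaS_mem_aff hV ψ.2
  isIntertwining' g := LinearMap.ext fun ψ => Subtype.ext (sigmaS_opRep g ψ.1).symm

theorem isSplitShortExact_curvToAlt :
    IsSplitShortExact (inclAffCurv V) (curvToAlt V) (altToCurv V) := by
  have split (ω) : curvToAlt V (altToCurv V ω) = ω := Subtype.ext <| by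
    change piA (rho14 (sigmaA ω.1)) = ω.1
    rw [rho14_sigmaA ω.2, piA_eq_self ω.2]
  refine ⟨Submodule.inclusion_injective aff_le_curv, fun R => ⟨fun hR => ?_, ?_⟩,
    fun ω => ⟨_, split ω⟩, split⟩
  · have piA_rho14 : piA (rho14 R.1) = 0 := congrArg Subtype.val hR
    exact ⟨⟨R.1, mem_aff_iff.2 ⟨R.2, piA_eq_zero_iff.1 piA_rho14⟩⟩, rfl⟩
  · rintro ⟨F, rfl⟩
    exact Subtype.ext (piA_eq_zero_iff.2 (mem_aff_iff.1 F.2).2)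

variable {V} in
theorem isSplitShortExact_affToSym (hV : 1 < finrank ℝ V) :
    IsSplitShortExact (inclProjUAff V) (affToSym V) (symToAff hV) := by
  have coe_affToSym (F) : (affToSym V F).1 = rho14 F.1 := piS_eq_self (mem_aff_iff.1 F.2).2
  have split (ψ) : affToSym V (symToAff hV ψ) = ψ := Subtype.ext <|
    (coe_affToSym _).trans (rho14_sigmaS hV ψ.1)
  refine ⟨Submodule.inclusion_injective projU_le_aff, fun F => ⟨fun hF => ?_, ?_⟩,
    fun ψ => ⟨_, split ψ⟩, split⟩
  · have rho14_eq : rho14 F.1 = 0 := (coe_affToSym F).symm.trans (congrArg Subtype.val hF)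
    exact ⟨⟨F.1, (mem_projU_iff_of_mem_aff F.2).2 rho14_eq⟩, rfl⟩
  · rintro ⟨U, rfl⟩
    exact Subtype.ext ((coe_affToSym _).trans U.2.1)

end Sequences

section Coefficients

variable {V ι : Type*} [AddCommGroup V] [Module ℝ V]

/-- The bilinear form with prescribed coefficients in a basis. -/
def bilOfCoeff (b : Basis ι ℝ V) (c : ι → ι → ℝ) : BilForm V :=
  b.constr ℝ fun i => b.constr ℝ (c i)

@[simp] theorem bilOfCoeff_apply (b : Basis ι ℝ V) (c : ι → ι → ℝ) (i j : ι) :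
    bilOfCoeff b c (b i) (b j) = c i j := by
  simp only [bilOfCoeff, Basis.constr_basis]

/-- The operator-valued bilinear form with prescribed values on a basis. -/
def opOfCoeff (b : Basis ι ℝ V) (c : ι → ι → ι → V) : OpForm V :=
  b.constr ℝ fun i => b.constr ℝ fun j => b.constr ℝ (c i j)

@[simp] theorem opOfCoeff_apply (b : Basis ι ℝ V) (c : ι → ι → ι → V) (i j k : ι) :
    opOfCoeff b c (b i) (b j) (b k) = c i j k := by
  simp only [opOfCoeff, Basis.constr_basis]

theorem bilForm_ext_basis (b : Basis ι ℝ V) {φ ψ : BilForm V}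
    (h : ∀ i j, φ (b i) (b j) = ψ (b i) (b j)) : φ = ψ :=
  b.ext fun i => b.ext fun j => h i j

theorem opForm_ext_basis (b : Basis ι ℝ V) {R S : OpForm V}
    (h : ∀ i j k, R (b i) (b j) (b k) = S (b i) (b j) (b k)) : R = S :=
  b.ext fun i => b.ext fun j => b.ext fun k => h i j k

theorem mem_sym_of_basis (b : Basis ι ℝ V) {ψ : BilForm V}
    (h : ∀ i j, ψ (b i) (b j) = ψ (b j) (b i)) : ψ ∈ symSubmodule V := by
  have flip_eq : ψ = ψ.flip := bilForm_ext_basis b h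
  exact fun x y => LinearMap.congr_fun₂ flip_eq x y

/-- The cyclic shift `(x, y, z) ↦ R z x y` of the arguments of `R`. -/
def cyclicShift (R : OpForm V) : OpForm V := LinearMap.lflip.toLinearMap ∘ₗ R.flip

theorem mem_curv_of_basis (b : Basis ι ℝ V) {R : OpForm V}
    (skew : ∀ i j k, R (b i) (b j) (b k) = -R (b j) (b i) (b k))
    (bianchi : ∀ i j k,
      R (b i) (b j) (b k) + R (b j) (b k) (b i) + R (b k) (b i) (b j) = 0) :
    R ∈ curvSubmodule V := by
  have skew' : R = -R.flip := opForm_ext_basis b skew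
  have bianchi' : R + cyclicShift (cyclicShift R) + cyclicShift R = 0 :=
    opForm_ext_basis b bianchi
  exact ⟨fun x y => LinearMap.congr_fun (LinearMap.congr_fun₂ skew' x y),
    fun x y => LinearMap.congr_fun (LinearMap.congr_fun₂ bianchi' x y)⟩

theorem apply_self_of_mem_curv {R : OpForm V} (hR : R ∈ curvSubmodule V) (x : V) :
    R x x = 0 := by
  ext z
  have := hR.1 x x z
  rwa [eq_neg_iff_add_eq_zero, ← two_smul ℝ, smul_eq_zero_iff_right two_ne_zero] at this

end Coefficients

section SemistandardTriples

/-- The index triples `(i, j, k)` that form a semistandard tableau of shape `(2,1)` with first row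
`i, k` and first column `i, j`. They index the free values of a curvature operator. -/
abbrev SemistandardTriple (ι : Type*) [LinearOrder ι] :=
  {t : ι × ι × ι // t.1 < t.2.1 ∧ t.1 ≤ t.2.2}

variable {ι W : Type*} [AddCommGroup W]

/-- Of the three cyclic shifts of a nonconstant triple exactly one is semistandard. -/
theorem card_semistandardTriple (ι : Type*) [Fintype ι] [LinearOrder ι] :
    3 * Fintype.card (SemistandardTriple ι) + Fintype.card ι = Fintype.card ι ^ 3 := by
  let s (a b c : ι) : ℕ := if a < b ∧ a ≤ c then 1 else 0
  let d (a b c : ι) : ℕ := if b = a ∧ c = a then 1 else 0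
  have shifts (a b c : ι) : d a b c + s a b c + s b c a + s c a b = 1 := by
    simp only [s, d]
    grind
  have sum_s : ∑ a, ∑ b, ∑ c, s a b c = Fintype.card (SemistandardTriple ι) := by
    rw [Fintype.card_subtype, Finset.card_filter, Fintype.sum_prod_type]
    simp only [Fintype.sum_prod_type, s]
  have sum_d : ∑ a, ∑ b, ∑ c, d a b c = Fintype.card ι := by
    simp [d, ite_and]
  have sum_shift (f : ι → ι → ι → ℕ) : ∑ a, ∑ b, ∑ c, f b c a = ∑ a, ∑ b, ∑ c, f a b c := by
    rw [Finset.sum_comm]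
    exact Finset.sum_congr rfl fun _ _ => Finset.sum_comm
  calc 3 * Fintype.card (SemistandardTriple ι) + Fintype.card ι
      = ∑ a, ∑ b, ∑ c, (d a b c + s a b c + s b c a + s c a b) := by
        simp only [Finset.sum_add_distrib]
        rw [sum_shift s, ← sum_shift fun a b c => s c a b, sum_d, sum_s]
        ring
    _ = Fintype.card ι ^ 3 := by
        simp only [shifts, Finset.sum_const, Finset.card_univ, smul_eq_mul, mul_one]
        ring

/-- The Young symmetrizer of shape `(2,1)`, applied to a function of three indices. -/
def youngSymmetrize (F : ι → ι → ι → W) (i j k : ι) : W :=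
  F i j k - F j i k + F k j i - F k i j

theorem youngSymmetrize_swap (F : ι → ι → ι → W) (i j k : ι) :
    youngSymmetrize F i j k = -youngSymmetrize F j i k := by
  unfold youngSymmetrize; abel

theorem youngSymmetrize_bianchi (F : ι → ι → ι → W) (i j k : ι) :
    youngSymmetrize F i j k + youngSymmetrize F j k i + youngSymmetrize F k i j = 0 := by
  unfold youngSymmetrize; abel

theorem exists_youngSymmetrize_eq [LinearOrder ι] [Module ℝ W] (f : SemistandardTriple ι → W) :
    ∃ F : ι → ι → ι → W, ∀ t : SemistandardTriple ι,
      youngSymmetrize F t.1.1 t.1.2.1 t.1.2.2 = f t := by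
  classical
  -- A triple `(i, j, i)` is counted twice by the symmetrizer, whence the factor `1 / 2`.
  refine ⟨fun i j k => if h : i < j ∧ i ≤ k then
    (if i = k then (1 / 2 : ℝ) else 1) • f ⟨(i, j, k), h⟩ else 0, fun ⟨⟨i, j, k⟩, hij, hik⟩ => ?_⟩
  simp only at hij hik
  rcases hik.eq_or_lt with rfl | hik'
  · simp only [youngSymmetrize, hij, hij.not_gt, le_refl, lt_irrefl, and_self, false_and,
      dite_true, dite_false, if_true, sub_zero]
    module
  · simp only [youngSymmetrize, hij, hij.not_gt, hik, hik'.not_ge, hik'.not_gt, hik'.ne, and_self,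
      and_false, false_and, dite_true, dite_false, if_false, sub_zero, add_zero, one_smul]

end SemistandardTriples

section CurvatureCoordinates

variable {V ι : Type*} [AddCommGroup V] [Module ℝ V] [LinearOrder ι]

/-- The values of a curvature operator at the semistandard triples of basis vectors. -/
def curvValues (b : Basis ι ℝ V) : curvSubmodule V →ₗ[ℝ] (SemistandardTriple ι → V) where
  toFun R t := R.1 (b t.1.1) (b t.1.2.1) (b t.1.2.2)
  map_add' _ _ := rfl
  map_smul' _ _ := rfl

theorem curvValues_injective (b : Basis ι ℝ V) : Function.Injective (curvValues b) := by
  refine (injective_iff_map_eq_zero _).2 fun ⟨R, hR⟩ hvals => ?_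
  have of_semistandard {i j k : ι} (hij : i < j) (hik : i ≤ k) : R (b i) (b j) (b k) = 0 :=
    congrFun hvals ⟨(i, j, k), hij, hik⟩
  have of_lt {i j : ι} (k : ι) (hij : i < j) : R (b i) (b j) (b k) = 0 := by
    rcases le_or_gt i k with hik | hki
    · exact of_semistandard hij hik
    · have bianchi := hR.2 (b i) (b j) (b k)
      rwa [hR.1 (b j) (b k), of_semistandard (hki.trans hij) hki.le,
        of_semistandard hki (hki.trans hij).le, neg_zero, add_zero, add_zero] at bianchi
  refine Subtype.ext (opForm_ext_basis b fun i j k => ?_)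
  rcases lt_trichotomy i j with hij | rfl | hji
  · exact of_lt k hij
  · exact LinearMap.congr_fun (apply_self_of_mem_curv hR (b i)) (b k)
  · exact (hR.1 _ _ _).trans (neg_eq_zero.2 (of_lt k hji))

theorem curvValues_surjective (b : Basis ι ℝ V) : Function.Surjective (curvValues b) := by
  intro f
  obtain ⟨F, hF⟩ := exists_youngSymmetrize_eq f
  refine ⟨⟨opOfCoeff b (youngSymmetrize F), mem_curv_of_basis b ?_ ?_⟩, ?_⟩
  · intro i j k
    simpa only [opOfCoeff_apply] using youngSymmetrize_swap F i j k
  · intro i j k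
    simpa only [opOfCoeff_apply] using youngSymmetrize_bianchi F i j k
  · ext1 t
    exact (opOfCoeff_apply b _ _ _ _).trans (hF t)

end CurvatureCoordinates

section Dimensions

variable {V ι : Type*} [AddCommGroup V] [Module ℝ V]

/-- Coefficients identify symmetric forms with functions on unordered pairs of indices. -/
def symEquiv (b : Basis ι ℝ V) : symSubmodule V ≃ₗ[ℝ] (Sym2 ι → ℝ) where
  toFun ψ := Sym2.lift ⟨fun i j => ψ.1 (b i) (b j), fun _ _ => ψ.2 _ _⟩
  map_add' φ ψ := by
    ext p; induction p with | _ i j => rfl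
  map_smul' c ψ := by
    ext p; induction p with | _ i j => rfl
  invFun f := ⟨bilOfCoeff b fun i j => f s(i, j), mem_sym_of_basis b fun i j => by
    rw [bilOfCoeff_apply, bilOfCoeff_apply, Sym2.eq_swap]⟩
  left_inv ψ := Subtype.ext (bilForm_ext_basis b fun i j => bilOfCoeff_apply b _ i j)
  right_inv f := by
    ext p; induction p with | _ i j => exact bilOfCoeff_apply b _ i j

theorem isCompl_alt_sym : IsCompl (altSubmodule V) (symSubmodule V) := by
  rw [isCompl_iff, Submodule.disjoint_def, codisjoint_iff, eq_top_iff]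
  refine ⟨fun ψ hAlt hSym => ?_, fun ψ _ => ?_⟩
  · rw [← piA_eq_self hAlt, piA_eq_zero_iff.2 hSym]
  · have decomp : ψ = piA ψ + piS ψ := by
      ext x y
      rw [LinearMap.add_apply, LinearMap.add_apply, piA_apply, piS_apply]
      ring
    rw [decomp]
    exact Submodule.add_mem_sup (piA_mem ψ) (piS_mem ψ)

variable (V) [FiniteDimensional ℝ V]

theorem finrank_sym : finrank ℝ (symSubmodule V) = (finrank ℝ V + 1).choose 2 := by
  rw [(symEquiv (finBasis ℝ V)).finrank_eq, finrank_fintype_fun_eq_card, Sym2.card,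
    Fintype.card_fin]

theorem finrank_alt_add_finrank_sym :
    finrank ℝ (altSubmodule V) + finrank ℝ (symSubmodule V) = finrank ℝ V ^ 2 := by
  have h := Submodule.finrank_add_eq_of_isCompl (K := ℝ) (V := BilForm V) isCompl_alt_sym
  rwa [finrank_linearMap, finrank_linearMap, finrank_self, mul_one, ← sq] at h

theorem finrank_curv : 3 * finrank ℝ (curvSubmodule V) + finrank ℝ V ^ 2 = finrank ℝ V ^ 4 := by
  let b := finBasis ℝ V
  let e := LinearEquiv.ofBijective (curvValues b) ⟨curvValues_injective b, curvValues_surjective b⟩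
  have card_triples := card_semistandardTriple (Fin (finrank ℝ V))
  rw [Fintype.card_fin] at card_triples
  rw [e.finrank_eq, finrank_pi_fintype, Finset.sum_const, Finset.card_univ, smul_eq_mul]
  linear_combination finrank ℝ V * card_triples

theorem cast_finrank_sym :
    (finrank ℝ (SymB V).toSubmodule : ℝ) = (finrank ℝ V : ℝ) * ((finrank ℝ V : ℝ) + 1) / 2 := by
  change (finrank ℝ (symSubmodule V) : ℝ) = _
  rw [finrank_sym, Nat.cast_choose_two]
  push_cast
  ring

theorem cast_finrank_aff :
    (finrank ℝ (AffF V).toSubmodule : ℝ) = (finrank ℝ V : ℝ) * ((finrank ℝ V : ℝ) - 1) *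
      (2 * (finrank ℝ V : ℝ) ^ 2 + 2 * (finrank ℝ V : ℝ) - 3) / 6 := by
  have curv : (3 * finrank ℝ (CurvR V).toSubmodule + finrank ℝ V ^ 2 : ℝ) = finrank ℝ V ^ 4 :=
    mod_cast finrank_curv V
  have curv_eq : (finrank ℝ (CurvR V).toSubmodule : ℝ) =
      finrank ℝ (AffF V).toSubmodule + finrank ℝ (Alt2 V).toSubmodule :=
    mod_cast (isSplitShortExact_curvToAlt V).finrank_eq
  have alt : (finrank ℝ (Alt2 V).toSubmodule + finrank ℝ (SymB V).toSubmodule : ℝ) =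
      finrank ℝ V ^ 2 :=
    mod_cast finrank_alt_add_finrank_sym V
  rw [cast_finrank_sym] at alt
  linear_combination curv / 3 - curv_eq - alt

variable {V} in
theorem cast_finrank_projU (hV : 1 < finrank ℝ V) :
    (finrank ℝ (ProjU V).toSubmodule : ℝ) =
      (finrank ℝ V : ℝ) ^ 2 * ((finrank ℝ V : ℝ) ^ 2 - 4) / 3 := by
  have aff_eq : (finrank ℝ (AffF V).toSubmodule : ℝ) =
      finrank ℝ (ProjU V).toSubmodule + finrank ℝ (SymB V).toSubmodule :=
    mod_cast (isSplitShortExact_affToSym hV).finrank_eq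
  rw [cast_finrank_aff, cast_finrank_sym] at aff_eq
  linear_combination -aff_eq

end Dimensions

section Irreducibility

variable {K G E : Type*} [Field K] [Group G] [AddCommGroup E] [Module K E]
  {ρ : Representation K G E} {U : Subrepresentation ρ}

theorem isIrreducible_of_isAtom (hU : IsAtom U) : U.toRepresentation.IsIrreducible := by
  have exists_ne_zero : ∃ v ∈ U.toSubmodule, v ≠ 0 := by
    refine Submodule.exists_mem_ne_zero_of_ne_bot fun h => hU.1 ?_
    exact Subrepresentation.toSubmodule_injective h
  obtain ⟨v, hv, hv0⟩ := exists_ne_zero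
  have bot_ne_top : (⊥ : Subrepresentation U.toRepresentation) ≠ ⊤ := fun h => by
    have mem_bot : (⟨v, hv⟩ : U.toSubmodule) ∈
        (⊥ : Subrepresentation U.toRepresentation).toSubmodule := by
      rw [h]; exact Submodule.mem_top
    exact hv0 (congrArg Subtype.val ((Submodule.mem_bot K).1 mem_bot))
  refine { exists_pair_ne := ⟨_, _, bot_ne_top⟩, eq_bot_or_eq_top := fun τ => ?_ }
  let N : Subrepresentation ρ :=
    { toSubmodule := τ.toSubmodule.map U.toSubmodule.subtype
      apply_mem_toSubmodule g := by
        rintro _ ⟨u, hu, rfl⟩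
        exact ⟨U.toRepresentation g u, τ.apply_mem_toSubmodule g hu, rfl⟩ }
  have N_le : N ≤ U := Submodule.map_subtype_le _ _
  have map_injective := Submodule.map_injective_of_injective
    (f := U.toSubmodule.subtype) Subtype.val_injective
  refine (hU.le_iff.1 N_le).imp (fun h => ?_) (fun h => ?_) <;>
    refine Subrepresentation.toSubmodule_injective (map_injective ?_)
  · exact (congrArg Subrepresentation.toSubmodule h).trans (Submodule.map_bot _).symm
  · exact (congrArg Subrepresentation.toSubmodule h).trans (Submodule.map_subtype_top _).symm

theorem submodule_eq_of_pairing [FiniteDimensional K E] {N U : Submodule K E} (hle : N ≤ U)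
    (B : E →ₗ[K] E →ₗ[K] K) (hB : ∀ R ∈ U, (∀ S ∈ N, B R S = 0) → R = 0) : N = U := by
  let F : U →ₗ[K] Dual K N := B.domRestrict₁₂ U N
  have F_injective : Function.Injective F :=
    (injective_iff_map_eq_zero F).2 fun R hR =>
      Subtype.ext (hB R.1 R.2 fun S hS => LinearMap.congr_fun hR ⟨S, hS⟩)
  refine Submodule.eq_of_le_of_finrank_le hle ?_
  have := LinearMap.finrank_le_finrank_of_injective F_injective
  rwa [Subspace.dual_finrank_eq] at this

theorem isIrreducible_of_orbit [FiniteDimensional K E] (hU : U ≠ ⊥) (e : E)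
    (he : ∀ N ≤ U, N ≠ ⊥ → e ∈ N.toSubmodule) (B : E →ₗ[K] E →ₗ[K] K)
    (hB : ∀ R ∈ U.toSubmodule, (∀ g, B R (ρ g e) = 0) → R = 0) :
    U.toRepresentation.IsIrreducible := by
  refine isIrreducible_of_isAtom ⟨hU, fun N hN => by_contra fun hN0 => hN.ne ?_⟩
  apply Subrepresentation.toSubmodule_injective
  exact submodule_eq_of_pairing hN.le B fun R hR hRN =>
    hB R hR fun g => hRN _ (N.apply_mem_toSubmodule g (he N hN.le hN0))

end Irreducibility

section Weights

variable {K E S : Type*} [Field K] [AddCommGroup E] [Module K E]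

open Polynomial in
theorem dual_aeval_apply {f : End K E} {c : Dual K E} {w : K} (hc : ∀ v, c (f v) = w * c v)
    (q : K[X]) (v : E) : c (aeval f q v) = q.eval w * c v := by
  induction q using Polynomial.induction_on generalizing v with
  | C a => simp
  | add p q hp hq => simp only [map_add, LinearMap.add_apply, hp, hq, eval_add, add_mul]
  | monomial n a ih =>
    rw [pow_succ, ← mul_assoc, map_mul, aeval_X, Module.End.mul_apply, ih, hc, eval_mul_X,
      mul_assoc]

open Polynomial in
theorem exists_weight_component [Finite S] {N : Submodule K E} {f : End K E} (hN : N ≤ N.comap f)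
    {c : S → Dual K E} {w : S → K} (hc : ∀ s v, c s (f v) = w s * c s v) {v : E} (hv : v ∈ N)
    (w₀ : K) :
    ∃ u ∈ N, (∀ s, w s = w₀ → c s u = c s v) ∧ ∀ s, w s ≠ w₀ → c s u = 0 := by
  classical
  have := Fintype.ofFinite S
  let q : K[X] := ∏ a ∈ (Finset.univ.image w).erase w₀, (X - C a)
  have eval_q (a : K) : q.eval a = ∏ d ∈ (Finset.univ.image w).erase w₀, (a - d) := by
    simp only [q, eval_prod, eval_sub, eval_X, eval_C]
  have eval_ne_zero : q.eval w₀ ≠ 0 := by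
    rw [eval_q, Finset.prod_ne_zero_iff]
    exact fun d hd => sub_ne_zero.2 (Finset.ne_of_mem_erase hd).symm
  have eval_eq_zero {s : S} (hs : w s ≠ w₀) : q.eval (w s) = 0 := by
    rw [eval_q]
    exact Finset.prod_eq_zero
      (Finset.mem_erase.2 ⟨hs, Finset.mem_image_of_mem w (Finset.mem_univ s)⟩) (sub_self _)
  have apply_component (s : S) :
      c s ((q.eval w₀)⁻¹ • aeval f q v) = (q.eval w₀)⁻¹ * (q.eval (w s) * c s v) := by
    rw [map_smul, dual_aeval_apply (hc s), smul_eq_mul]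
  refine ⟨(q.eval w₀)⁻¹ • aeval f q v,
    N.smul_mem _ (aeval_apply_smul_mem_of_le_comap hv q f hN), fun s hs => ?_, fun s hs => ?_⟩ <;>
    rw [apply_component]
  · rw [hs, inv_mul_cancel_left₀ eval_ne_zero]
  · rw [eval_eq_zero hs, zero_mul, mul_zero]

end Weights

section LinearAlgebra

variable {K V ι : Type*} [Field K] [AddCommGroup V] [Module K V]

theorem exists_basis_extending [Finite ι] (b₀ : Basis ι K V) {n : ℕ} (e : Fin n ↪ ι)
    {v : Fin n → V} (hv : LinearIndependent K v) : ∃ b : Basis ι K V, ∀ k, b (e k) = v k := by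
  let b₁ := Basis.extend hv.linearIndepOn_id
  let inclusion : Fin n ↪ hv.linearIndepOn_id.extend (Set.subset_univ _) :=
    ⟨fun k => ⟨v k, Basis.subset_extend _ (Set.mem_range_self k)⟩,
      fun _ _ h => hv.injective (congrArg Subtype.val h)⟩
  let σ := b₁.indexEquiv b₀
  have := Equiv.Perm.isMultiplyPretransitive ι n
  obtain ⟨τ, hτ⟩ := MulAction.exists_smul_eq (Equiv.Perm ι) (inclusion.trans σ.toEmbedding) e
  have index_eq (k : Fin n) : τ (σ (inclusion k)) = e k := DFunLike.congr_fun hτ k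
  refine ⟨b₁.reindex (σ.trans τ), fun k => ?_⟩
  rw [Basis.reindex_apply, ← index_eq, Equiv.symm_trans_apply, Equiv.symm_apply_apply,
    Equiv.symm_apply_apply]
  exact Basis.extend_apply_self _ _

theorem exists_eq_smul_add_of_mem_span_pair {x : V} {f : V →ₗ[K] V}
    (hf : ∀ v, f v ∈ Submodule.span K {x, v}) :
    ∃ (c : K) (l : Dual K V), ∀ v, f v = c • v + l v • x := by
  let L := Submodule.span K {x}
  have f_mem : L ≤ L.comap f := by
    rw [Submodule.span_singleton_le_iff_mem, Submodule.mem_comap]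
    simpa only [Set.pair_eq_singleton] using hf x
  obtain ⟨c, hc⟩ : ∃ c : K, L.mapQ L f f_mem = c • 1 := by
    refine LinearMap.exists_eq_smul_id_of_forall_notLinearIndependent fun y => ?_
    obtain ⟨v, rfl⟩ := L.mkQ_surjective y
    obtain ⟨a, c, h⟩ := Submodule.mem_span_pair.1 (hf v)
    rw [LinearIndependent.pair_iff]
    intro hli
    have := (hli c (-1) ?_).2
    · norm_num at this
    · rw [Submodule.mkQ_apply, Submodule.mapQ_apply, ← Submodule.Quotient.mk_smul,
        ← Submodule.Quotient.mk_smul, ← Submodule.Quotient.mk_add, Submodule.Quotient.mk_eq_zero,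
        ← h]
      exact Submodule.mem_span_singleton.2 ⟨-a, by module⟩
  have sub_mem (v : V) : (f - c • 1) v ∈ LinearMap.range (LinearMap.toSpanSingleton K V x) := by
    rw [LinearMap.range_toSpanSingleton, ← Submodule.Quotient.mk_eq_zero]
    have := LinearMap.congr_fun hc (L.mkQ v)
    simpa [sub_eq_zero] using this
  obtain ⟨l, hl⟩ := Module.projective_lifting_property
    (LinearMap.toSpanSingleton K V x).rangeRestrict ((f - c • 1).codRestrict _ sub_mem)
    (LinearMap.surjective_rangeRestrict _)
  refine ⟨c, l, fun v => ?_⟩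
  have : l v • x = f v - c • v := congrArg Subtype.val (LinearMap.congr_fun hl v)
  rw [this]
  abel

end LinearAlgebra

section RicciFlat

variable {V : Type*} [AddCommGroup V] [Module ℝ V] {R : OpForm V}

theorem exists_dual_of_mem_span_pair [FiniteDimensional ℝ V] (hV : 1 < finrank ℝ V)
    (hR : R ∈ curvSubmodule V) {x : V} (hx : rho14 R x x = 0)
    (h : ∀ y, R y x x ∈ Submodule.span ℝ {x, y}) :
    ∃ l : Dual ℝ V, (x = 0 → l = 0) ∧ ∀ y, R y x x = l y • x := by
  by_cases hx0 : x = 0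
  · exact ⟨0, fun _ => rfl, fun y => by simp [hx0]⟩
  obtain ⟨c, l, hl⟩ := exists_eq_smul_add_of_mem_span_pair (f := (R.flip x).flip x) h
  have l_self : c + l x = 0 := by
    have : (c + l x) • x = 0 := by
      rw [add_smul, ← hl x]; exact LinearMap.congr_fun (apply_self_of_mem_curv hR x) x
    exact (smul_eq_zero.1 this).resolve_right hx0
  have trace_eq : c * finrank ℝ V + l x = 0 := by
    have : (R.flip x).flip x = c • LinearMap.id + l.smulRight x := LinearMap.ext hl
    change LinearMap.trace ℝ V ((R.flip x).flip x) = 0 at hx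
    rwa [this, map_add, map_smul, LinearMap.trace_id, LinearMap.trace_smulRight,
      smul_eq_mul] at hx
  have c_eq : c = 0 := by
    have hm : (finrank ℝ V : ℝ) - 1 ≠ 0 := sub_ne_zero.2 (by exact_mod_cast hV.ne')
    refine (mul_eq_zero.1 (?_ : c * (finrank ℝ V - 1) = 0)).resolve_right hm
    linear_combination trace_eq - l_self
  refine ⟨l, fun h0 => absurd h0 hx0, fun y => ?_⟩
  have := hl y
  rwa [c_eq, zero_smul, zero_add] at this

theorem apply_eq_zero_of_not_linearIndependent (hR : R ∈ curvSubmodule V) {x y : V}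
    (h : ¬LinearIndependent ℝ ![x, y]) : R x y = 0 := by
  by_cases hx : x = 0
  · rw [hx, map_zero, LinearMap.zero_apply]
  · rw [LinearIndependent.pair_iff' hx] at h
    push Not at h
    obtain ⟨t, rfl⟩ := h
    rw [map_smul, apply_self_of_mem_curv hR, smul_zero]

/-- `x`, `y` and `x + y` are eigenvectors of `R(x,y) = R(x,x+y)`, so their eigenvalues agree. -/
theorem dual_apply_swap (hR : R ∈ curvSubmodule V) {l : V → Dual ℝ V} (hl0 : l 0 = 0)
    (hl : ∀ x y, R y x x = l x y • x) (x y : V) : l y x = -l x y := by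
  by_cases hli : LinearIndependent ℝ ![x, y]
  · have eigen_sum : (l (x + y) x + l x y) • x + (l (x + y) x - l y x) • y = 0 := by
      have := hl (x + y) x
      rw [map_add (R x), apply_self_of_mem_curv hR, zero_add, map_add, hR.1 x y x, hl, hl] at this
      rw [← sub_eq_zero.2 this.symm]
      module
    have ⟨h₁, h₂⟩ := LinearIndependent.pair_iff.1 hli _ _ eigen_sum
    linarith
  · have eq_zero {a b : V} (h : R b a a = 0) : l a b = 0 := by
      by_cases ha : a = 0
      · rw [ha, hl0, LinearMap.zero_apply]
      · exact (smul_eq_zero.1 ((hl a b).symm.trans h)).resolve_right ha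
    have R_eq := apply_eq_zero_of_not_linearIndependent hR hli
    rw [eq_zero (by rw [R_eq]; rfl), eq_zero (by rw [hR.1, R_eq]; exact neg_zero), neg_zero]

theorem exists_alt_of_apply_eq_smul (hR : R ∈ curvSubmodule V)
    (h : ∀ x, ∃ l : Dual ℝ V, (x = 0 → l = 0) ∧ ∀ y, R y x x = l y • x) :
    ∃ ω ∈ altSubmodule V, ∀ x y, R y x x = ω y x • x := by
  choose l hl0 hl using h
  have swap := dual_apply_swap hR (hl0 0 rfl) hl
  let ω : BilForm V := LinearMap.flip
    { toFun := l
      map_add' x y := LinearMap.ext fun z => by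
        rw [LinearMap.add_apply, swap z, swap z x, swap z y, map_add, neg_add]
      map_smul' c x := LinearMap.ext fun z => by
        rw [RingHom.id_apply, LinearMap.smul_apply, swap z, swap z x, map_smul, smul_neg] }
  exact ⟨ω, fun x y => swap x y, hl⟩

theorem eq_sigmaA_of_apply_eq_smul (hR : R ∈ curvSubmodule V) {ω : BilForm V}
    (hω : ω ∈ altSubmodule V) (h : ∀ x y, R y x x = ω y x • x) :
    R = sigmaA ((-(1 + finrank ℝ V) / 3 : ℝ) • ω) := by
  have polarized (x y z : V) : R z x y + R z y x = ω z x • y + ω z y • x := by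
    have := h (x + y) z
    simp only [map_add, LinearMap.add_apply, h, add_smul, smul_add] at this
    rw [← sub_eq_zero] at this ⊢
    rw [← this]
    abel
  ext x y z
  have bianchi := hR.2 x y z
  have h₁ := polarized y z x
  have h₂ := polarized x y z
  rw [hR.1 x z y] at h₁
  rw [hR.1 z y x] at h₂
  rw [hω z x, hω z y] at h₂
  have hm : (1 + finrank ℝ V : ℝ) ≠ 0 := by positivity
  have scale : -1 / (1 + finrank ℝ V : ℝ) * (-(1 + finrank ℝ V) / 3) = 1 / 3 := by field_simp
  calc R x y z
      = (1 / 3 : ℝ) • (2 • (R x y z + -R z x y) + (R z x y + -R y z x)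
          + (R x y z + R y z x + R z x y)) := by module
    _ = (1 / 3 : ℝ) • ((2 * ω x y) • z + ω x z • y - ω y z • x) := by
      rw [h₁, h₂, bianchi]; module
    _ = sigmaA ((-(1 + finrank ℝ V) / 3 : ℝ) • ω) x y z := by
      rw [← scale, sigmaA_apply]
      simp only [LinearMap.smul_apply, smul_eq_mul]
      module

theorem eq_zero_of_mem_span_pair [FiniteDimensional ℝ V] (hV : 1 < finrank ℝ V)
    (hR : R ∈ (ProjU V).toSubmodule) (h : ∀ x y, R x y x ∈ Submodule.span ℝ {x, y}) : R = 0 := by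
  have hρ : rho14 R = 0 := hR.1
  obtain ⟨ω, hω, hRω⟩ := exists_alt_of_apply_eq_smul hR.2 fun x =>
    exists_dual_of_mem_span_pair hV hR.2 (by rw [hρ]; rfl) fun y => by
      rw [hR.2.1]; exact neg_mem (h x y)
  have R_eq := eq_sigmaA_of_apply_eq_smul hR.2 hω hRω
  rw [R_eq, rho14_sigmaA ((altSubmodule V).smul_mem _ hω)] at hρ
  rw [R_eq, hρ]
  exact map_zero (sigmaALin V)

end RicciFlat

section BasisTransforms

variable {V ι : Type*} [AddCommGroup V] [Module ℝ V]

/-- The element of `GL(V)` that maps the basis `b` to the basis `b'`. -/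
def basisGL (b b' : Basis ι ℝ V) : GLV V :=
  LinearMap.GeneralLinearGroup.ofLinearEquiv (b.equiv b' (.refl ι))

theorem basisGL_apply (b b' : Basis ι ℝ V) (i : ι) : (basisGL b b').1 (b i) = b' i :=
  b.equiv_apply i b' (.refl ι)

theorem coord_basisGL_inv (b b' : Basis ι ℝ V) (i : ι) :
    b.coord i ∘ₗ (basisGL b b')⁻¹.1 = b'.coord i := by
  refine b'.ext fun k => ?_
  change b.coord i ((b.equiv b' (.refl ι)).symm (b' k)) = b'.coord i (b' k)
  rw [Basis.equiv_symm, Basis.equiv_apply, Equiv.refl_symm, Equiv.refl_apply]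
  simp only [Basis.coord_apply, Basis.repr_self]

/-- The diagonal element of `GL(V)` with eigenvalues `2 ^ n i` on the vectors of a basis. -/
def diagGL (b : Basis ι ℝ V) (n : ι → ℤ) : GLV V :=
  basisGL b (b.unitsSMul fun i => Units.mk0 (2 : ℝ) two_ne_zero ^ n i)

theorem diagGL_inv_apply (b : Basis ι ℝ V) (n : ι → ℤ) (i : ι) :
    (diagGL b n)⁻¹.1 (b i) = (2 : ℝ) ^ (-n i) • b i := by
  have apply_basis : (diagGL b n).1 (b i) = (2 : ℝ) ^ n i • b i := by
    rw [diagGL, basisGL_apply, Basis.unitsSMul_apply, Units.smul_def, Units.val_zpow_eq_zpow_val,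
      Units.val_mk0]
  have inv_apply : (diagGL b n)⁻¹.1 ((diagGL b n).1 (b i)) = b i :=
    LinearMap.congr_fun (diagGL b n).inv_mul (b i)
  rw [apply_basis, map_smul] at inv_apply
  rw [zpow_neg, eq_inv_smul_iff₀ (by positivity), inv_apply]

theorem coord_diagGL (b : Basis ι ℝ V) (n : ι → ℤ) (i : ι) (x : V) :
    b.coord i ((diagGL b n).1 x) = (2 : ℝ) ^ n i * b.coord i x := by
  classical
  suffices b.coord i ∘ₗ (diagGL b n).1 = (2 : ℝ) ^ n i • b.coord i from LinearMap.congr_fun this x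
  refine b.ext fun k => ?_
  rw [LinearMap.comp_apply, diagGL, basisGL_apply, Basis.unitsSMul_apply, Units.smul_def,
    map_smul, LinearMap.smul_apply, Units.val_zpow_eq_zpow_val, Units.val_mk0]
  obtain rfl | hki := eq_or_ne k i
  · rfl
  · simp [hki]

variable [Finite ι] [DecidableEq ι]

/-- The basis dual to `c` for the inner product in which `b` is orthonormal. -/
def contragredient (b c : Basis ι ℝ V) : Basis ι ℝ V := c.dualBasis.map b.toDualEquiv.symm

theorem toDual_contragredient (b c : Basis ι ℝ V) (i : ι) :
    b.toDual (contragredient b c i) = c.coord i := by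
  rw [contragredient, Basis.map_apply, Basis.coe_dualBasis, ← Basis.toDualEquiv_apply,
    LinearEquiv.apply_symm_apply]

theorem coord_contragredient (b c : Basis ι ℝ V) (i : ι) :
    (contragredient b c).coord i = b.toDual.flip (c i) := by
  ext x
  rw [contragredient, Basis.coord_apply, Basis.map_repr, LinearEquiv.trans_apply,
    LinearEquiv.symm_symm, Basis.dualBasis_repr, Basis.toDualEquiv_apply, LinearMap.flip_apply]

end BasisTransforms

section Pairings

variable {V ι : Type*} [AddCommGroup V] [Module ℝ V]

/-- The bilinear form `(u, v) ↦ ∑ s, c s u * c s v` attached to a finite family of linear forms,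
an inner product if the `c s` are coordinates. -/
def coeffPairing {K E S : Type*} [CommRing K] [AddCommGroup E] [Module K E] [Fintype S]
    (c : S → Dual K E) : E →ₗ[K] E →ₗ[K] K :=
  ∑ s, (c s).smulRight (c s)

theorem coeffPairing_apply {K E S : Type*} [CommRing K] [AddCommGroup E] [Module K E] [Fintype S]
    (c : S → Dual K E) (u v : E) : coeffPairing c u v = ∑ s, c s u * c s v := by
  simp only [coeffPairing, LinearMap.sum_apply, LinearMap.smulRight_apply, LinearMap.smul_apply,
    smul_eq_mul]

/-- The coefficients of a bilinear form in a basis. -/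
def bilCoeff (b : Basis ι ℝ V) (s : ι × ι) : Dual ℝ (BilForm V) :=
  LinearMap.applyₗ (b s.2) ∘ₗ LinearMap.applyₗ (b s.1)

/-- The coefficients of an operator-valued bilinear form in a basis. -/
def opCoeff (b : Basis ι ℝ V) (s : ι × ι × ι × ι) : Dual ℝ (OpForm V) :=
  b.coord s.2.2.2 ∘ₗ LinearMap.applyₗ (b s.2.2.1) ∘ₗ LinearMap.applyₗ (b s.2.1) ∘ₗ
    LinearMap.applyₗ (b s.1)

/-- The square of a linear form. -/
def sqForm (α : Dual ℝ V) : BilForm V := α.smulRight α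

theorem sqForm_apply (α : Dual ℝ V) (x y : V) : sqForm α x y = α x * α y := rfl

/-- The curvature operator `(x, y) ↦ (α ∧ β)(x, y) • α ⊗ v`; it lies in `𝔘(V)` if `α v = β v = 0`,
and is then a highest weight vector. -/
def wedgeForm (α β : Dual ℝ V) (v : V) : OpForm V :=
  (α.smulRight β - β.smulRight α).compr₂
    (LinearMap.toSpanSingleton ℝ (V →ₗ[ℝ] V) (α.smulRight v))

theorem wedgeForm_apply (α β : Dual ℝ V) (v x y z : V) :
    wedgeForm α β v x y z = ((α x * β y - β x * α y) * α z) • v :=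
  smul_smul _ _ _

theorem bilRep_sqForm (g : GLV V) (α : Dual ℝ V) :
    bilRep V g (sqForm α) = sqForm (α ∘ₗ g⁻¹.1) := rfl

theorem opRep_wedgeForm (g : GLV V) (α β : Dual ℝ V) (v : V) :
    opRep V g (wedgeForm α β v) = wedgeForm (α ∘ₗ g⁻¹.1) (β ∘ₗ g⁻¹.1) (g.1 v) := by
  ext x y z
  rw [opRep_apply, wedgeForm_apply, wedgeForm_apply, map_smul]
  rfl

theorem bilCoeff_diagGL (b : Basis ι ℝ V) (n : ι → ℤ) (ψ : BilForm V) (p q : ι) :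
    bilCoeff b (p, q) (bilRep V (diagGL b n) ψ) =
      2 ^ (-n p - n q) * bilCoeff b (p, q) ψ := by
  change ψ ((diagGL b n)⁻¹.1 (b p)) ((diagGL b n)⁻¹.1 (b q)) = _ * ψ (b p) (b q)
  simp only [diagGL_inv_apply, map_smul, LinearMap.smul_apply, smul_eq_mul, sub_eq_add_neg,
    zpow_add₀ (two_ne_zero (α := ℝ))]
  ring

theorem opCoeff_diagGL (b : Basis ι ℝ V) (n : ι → ℤ) (R : OpForm V) (p q s t : ι) :
    opCoeff b (p, q, s, t) (opRep V (diagGL b n) R) =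
      2 ^ (n t - n p - n q - n s) * opCoeff b (p, q, s, t) R := by
  change b.coord t ((diagGL b n).1 (R ((diagGL b n)⁻¹.1 (b p)) ((diagGL b n)⁻¹.1 (b q))
    ((diagGL b n)⁻¹.1 (b s)))) = _ * b.coord t (R (b p) (b q) (b s))
  simp only [coord_diagGL, diagGL_inv_apply, map_smul, LinearMap.smul_apply, smul_eq_mul,
    sub_eq_add_neg, zpow_add₀ (two_ne_zero (α := ℝ))]
  ring

variable [Fintype ι]

theorem sum_mul_repr (b : Basis ι ℝ V) (l : Dual ℝ V) (x : V) :
    ∑ i, l (b i) * b.repr x i = l x := by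
  conv_rhs => rw [← b.sum_repr x]
  simp only [map_sum, map_smul, smul_eq_mul, mul_comm]

theorem sum_bilCoeff_mul (b : Basis ι ℝ V) (ψ : BilForm V) (x y : V) :
    ∑ s, bilCoeff b s ψ * (b.repr y s.2 * b.repr x s.1) = ψ x y :=
  calc
    _ = ∑ p, (∑ q, ψ (b p) (b q) * b.repr y q) * b.repr x p := by
      simp only [Fintype.sum_prod_type, ← mul_assoc, ← Finset.sum_mul]; rfl
    _ = ψ x y := by
      simp only [sum_mul_repr]; exact sum_mul_repr b (ψ.flip y) x

variable [DecidableEq ι]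

theorem sum_opCoeff_mul (b : Basis ι ℝ V) (R : OpForm V) (x y z v : V) :
    ∑ s, opCoeff b s R * (b.repr v s.2.2.2 * b.repr z s.2.2.1 * b.repr y s.2.1 * b.repr x s.1) =
      b.toDual v (R x y z) := by
  have sum_coord (w : V) : ∑ t, b.repr w t * b.repr v t = b.toDual v w := by
    simpa only [Basis.toDual_apply_right, LinearMap.flip_apply] using
      sum_mul_repr b (b.toDual.flip w) v
  calc
    _ = ∑ p, (∑ q, (∑ s, (∑ t, b.repr (R (b p) (b q) (b s)) t * b.repr v t) *
          b.repr z s) * b.repr y q) * b.repr x p := by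
      simp only [Fintype.sum_prod_type, ← mul_assoc, ← Finset.sum_mul]; rfl
    _ = ∑ p, (∑ q, b.toDual v (R (b p) (b q) z) * b.repr y q) * b.repr x p := by
      simp only [sum_coord]
      simp only [← LinearMap.comp_apply (b.toDual v), sum_mul_repr]
    _ = ∑ p, b.toDual v (R (b p) y z) * b.repr x p :=
      Finset.sum_congr rfl fun p _ => congrArg (· * _)
        (sum_mul_repr b (b.toDual v ∘ₗ (R (b p)).flip z) y)
    _ = b.toDual v (R x y z) := sum_mul_repr b (b.toDual v ∘ₗ (R.flip y).flip z) x

theorem coeffPairing_sqForm (b : Basis ι ℝ V) (ψ : BilForm V) (x : V) :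
    coeffPairing (bilCoeff b) ψ (sqForm (b.toDual.flip x)) = ψ x x := by
  rw [← sum_bilCoeff_mul b ψ, coeffPairing_apply]
  refine Finset.sum_congr rfl fun s _ => congrArg _ ?_
  change b.toDual (b s.1) x * b.toDual (b s.2) x = _
  rw [Basis.toDual_apply_right, Basis.toDual_apply_right, mul_comm]

theorem coeffPairing_wedgeForm (b : Basis ι ℝ V) {R : OpForm V} (hR : R ∈ curvSubmodule V)
    (x y v : V) :
    coeffPairing (opCoeff b) R (wedgeForm (b.toDual.flip x) (b.toDual.flip y) v) =
      2 * b.toDual v (R x y x) := by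
  have skew : R x y x - R y x x = (2 : ℝ) • R x y x := by rw [hR.1 y x]; module
  rw [← smul_eq_mul, ← map_smul, ← skew, map_sub, ← sum_opCoeff_mul,
    ← sum_opCoeff_mul, ← Finset.sum_sub_distrib, coeffPairing_apply]
  refine Finset.sum_congr rfl fun ⟨p, q, s, t⟩ _ => ?_
  have coeff_wedge : opCoeff b (p, q, s, t) (wedgeForm (b.toDual.flip x) (b.toDual.flip y) v) =
      (b.repr x p * b.repr y q - b.repr y p * b.repr x q) * b.repr x s * b.repr v t := by
    change b.coord t (wedgeForm _ _ v (b p) (b q) (b s)) = _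
    simp only [wedgeForm_apply, LinearMap.flip_apply, Basis.toDual_apply_right, map_smul,
      Basis.coord_apply, smul_eq_mul]
  rw [coeff_wedge]
  ring

end Pairings

section SymmetricForms

variable {V ι : Type*} [AddCommGroup V] [Module ℝ V] [Finite ι] {ψ : BilForm V}

theorem exists_basis_apply_self_ne_zero (hψ : ψ ∈ symSubmodule V) (hψ0 : ψ ≠ 0)
    (b : Basis ι ℝ V) (i : ι) : ∃ c : Basis ι ℝ V, ψ (c i) (c i) ≠ 0 := by
  obtain ⟨x, hx⟩ := LinearMap.BilinForm.exists_bilinForm_self_ne_zero hψ0 ⟨hψ⟩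
  have hx0 : x ≠ 0 := by rintro rfl; exact hx (map_zero _)
  obtain ⟨c, hc⟩ := exists_basis_extending b ⟨![i], Function.injective_of_subsingleton _⟩
    (v := ![x]) (LinearIndependent.of_subsingleton 0 hx0)
  refine ⟨c, ?_⟩
  rwa [show c i = x from hc 0]

theorem sqForm_mem_of_apply_ne_zero {N : Subrepresentation (bilRep V)} (hψ : ψ ∈ N.toSubmodule)
    (b : Basis ι ℝ V) {i : ι} (h : ψ (b i) (b i) ≠ 0) : sqForm (b.coord i) ∈ N.toSubmodule := by
  classical
  let n : ι → ℤ := fun a => if a = i then -1 else 0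
  have weight_iff (p q : ι) : -n p - n q = 2 ↔ p = i ∧ q = i := by
    by_cases hp : p = i <;> by_cases hq : q = i <;> simp [n, hp, hq]
  obtain ⟨φ, hφ, hφ_eq, hφ_zero⟩ := exists_weight_component (E := BilForm V)
    (f := bilRep V (diagGL b n)) (fun _ hφ => N.apply_mem_toSubmodule _ hφ) (c := bilCoeff b)
    (w := fun s => 2 ^ (-n s.1 - n s.2)) (fun s φ => bilCoeff_diagGL b n φ s.1 s.2)
    hψ (2 ^ (2 : ℤ))
  have φ_eq : φ = ψ (b i) (b i) • sqForm (b.coord i) := by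
    refine bilForm_ext_basis b fun p q => ?_
    rw [LinearMap.smul_apply, LinearMap.smul_apply, sqForm_apply, smul_eq_mul]
    by_cases hpq : p = i ∧ q = i
    · have coeff : φ (b p) (b q) = ψ (b p) (b q) :=
        hφ_eq (p, q) (congrArg _ ((weight_iff p q).2 hpq))
      rw [coeff, hpq.1, hpq.2, Basis.coord_apply, Basis.repr_self, Finsupp.single_eq_same,
        mul_one, mul_one]
    · have coeff : φ (b p) (b q) = 0 := hφ_zero (p, q) fun h => hpq <| (weight_iff p q).1 <|
        zpow_right_injective₀ two_pos (by norm_num) h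
      simp only [Basis.coord_apply, Basis.repr_self, Finsupp.single_apply]
      rw [coeff, ite_zero_mul_ite_zero, if_neg hpq, mul_zero]
  rwa [φ_eq, Submodule.smul_mem_iff _ h] at hφ

theorem isIrreducible_symB [FiniteDimensional ℝ V] [Nontrivial V] :
    (SymB V).toRepresentation.IsIrreducible := by
  let b := finBasis ℝ V
  let i : Fin (finrank ℝ V) := ⟨0, finrank_pos⟩
  refine isIrreducible_of_orbit (K := ℝ) ?_ (sqForm (b.coord i)) (fun N hN hN0 => ?_)
    (coeffPairing (K := ℝ) (E := BilForm V) (bilCoeff b))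
    fun φ hφ hφ_orbit => by_contra fun hφ0 => ?_
  · have sqForm_mem : sqForm (b.coord i) ∈ (SymB V).toSubmodule := fun x y => mul_comm _ _
    rintro h
    rw [h] at sqForm_mem
    have := LinearMap.congr_fun₂ ((Submodule.mem_bot ℝ).1 sqForm_mem) (b i) (b i)
    simp [sqForm_apply] at this
  · obtain ⟨ψ, hψ, hψ0⟩ := Submodule.exists_mem_ne_zero_of_ne_bot fun h =>
      hN0 (Subrepresentation.toSubmodule_injective h)
    obtain ⟨c, hc⟩ := exists_basis_apply_self_ne_zero (hN hψ) hψ0 b i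
    have := N.apply_mem_toSubmodule (basisGL c b) (sqForm_mem_of_apply_ne_zero hψ c hc)
    rwa [bilRep_sqForm, coord_basisGL_inv] at this
  · obtain ⟨c, hc⟩ := exists_basis_apply_self_ne_zero hφ hφ0 b i
    have := hφ_orbit (basisGL b (contragredient b c))
    rw [bilRep_sqForm, coord_basisGL_inv, coord_contragredient, coeffPairing_sqForm] at this
    exact hc this

end SymmetricForms

section RicciFlatIrreducible

variable {V ι : Type*}

open Classical in
/-- The exponents of the one-parameter group whose top weight on curvature operators is `6`, with
weight vector `wedgeForm (b.coord i) (b.coord j) (b l)`. -/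
def wedgeExponent (l i j a : ι) : ℤ :=
  if a = l then 1 else if a = i then -2 else if a = j then -1 else 0

theorem wedgeExponent_eq_six_iff {l i j p q s t : ι} (hli : l ≠ i) (hlj : l ≠ j)
    (hpq : p ≠ q) :
    wedgeExponent l i j t - wedgeExponent l i j p - wedgeExponent l i j q -
      wedgeExponent l i j s = 6 ↔ ((p = i ∧ q = j ∨ p = j ∧ q = i) ∧ s = i) ∧ t = l := by
  let n := wedgeExponent l i j
  have le_one (a : ι) : n a ≤ 1 ∧ (n a = 1 ↔ a = l) := by
    simp only [n, wedgeExponent]; grind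
  have neg_two_le (a : ι) : -2 ≤ n a ∧ (n a = -2 ↔ a = i) := by
    simp only [n, wedgeExponent]; grind
  have neg_three_le : -3 ≤ n p + n q ∧ (n p + n q = -3 ↔ p = i ∧ q = j ∨ p = j ∧ q = i) := by
    simp only [n, wedgeExponent]; grind
  have ht := le_one t
  have hs := neg_two_le s
  change n t - n p - n q - n s = 6 ↔ _
  rw [← ht.2, ← hs.2, ← neg_three_le.2]
  lia

variable [AddCommGroup V] [Module ℝ V] [Finite ι] {R : OpForm V}

theorem exists_basis_coord_apply_ne_zero [FiniteDimensional ℝ V] (hV : 1 < finrank ℝ V)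
    (hR : R ∈ (ProjU V).toSubmodule) (hR0 : R ≠ 0) (b : Basis ι ℝ V) (e : Fin 3 ↪ ι) :
    ∃ c : Basis ι ℝ V, c.coord (e 0) (R (c (e 1)) (c (e 2)) (c (e 1))) ≠ 0 := by
  obtain ⟨x, y, hxy⟩ : ∃ x y, R x y x ∉ Submodule.span ℝ {x, y} := by
    by_contra! h
    exact hR0 (eq_zero_of_mem_span_pair hV hR h)
  have hli : LinearIndependent ℝ ![R x y x, x, y] := by
    refine linearIndependent_finCons.2 ⟨by_contra fun h => hxy ?_, ?_⟩
    · rw [apply_eq_zero_of_not_linearIndependent hR.2 h]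
      exact zero_mem _
    · rwa [Matrix.range_cons_cons_empty]
  obtain ⟨c, hc⟩ := exists_basis_extending b e hli
  have h₀ : c (e 0) = R x y x := hc 0
  have h₁ : c (e 1) = x := hc 1
  have h₂ : c (e 2) = y := hc 2
  refine ⟨c, ?_⟩
  rw [h₁, h₂, ← h₀]
  simp

theorem wedgeForm_mem_of_coord_ne_zero {N : Subrepresentation (opRep V)}
    (hN : N.toSubmodule ≤ curvSubmodule V) (hR : R ∈ N.toSubmodule) (b : Basis ι ℝ V)
    {l i j : ι} (hli : l ≠ i) (hlj : l ≠ j)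
    (h : b.coord l (R (b i) (b j) (b i)) ≠ 0) :
    wedgeForm (b.coord i) (b.coord j) (b l) ∈ N.toSubmodule := by
  classical
  let n := wedgeExponent l i j
  obtain ⟨S, hS, hS_eq, hS_zero⟩ := exists_weight_component (E := OpForm V)
    (f := opRep V (diagGL b n)) (fun _ hS => N.apply_mem_toSubmodule _ hS) (c := opCoeff b)
    (w := fun s => 2 ^ (n s.2.2.2 - n s.1 - n s.2.1 - n s.2.2.1))
    (fun s S => opCoeff_diagGL b n S s.1 s.2.1 s.2.2.1 s.2.2.2) hR (2 ^ (6 : ℤ))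
  have S_eq : S = b.coord l (R (b i) (b j) (b i)) • wedgeForm (b.coord i) (b.coord j) (b l) := by
    refine opForm_ext_basis b fun p q s => b.ext_elem fun t => ?_
    simp only [LinearMap.smul_apply, wedgeForm_apply, map_smul, Finsupp.smul_apply,
      Basis.coord_apply, Basis.repr_self, smul_eq_mul, Finsupp.single_apply]
    obtain rfl | hpq := eq_or_ne p q
    · rw [apply_self_of_mem_curv (hN hS)]
      simp only [LinearMap.zero_apply, map_zero, Finsupp.zero_apply]
      ring
    have weight_iff := wedgeExponent_eq_six_iff (s := s) (t := t) hli hlj hpq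
    by_cases hw : ((p = i ∧ q = j ∨ p = j ∧ q = i) ∧ s = i) ∧ t = l
    · have coeff : b.repr (S (b p) (b q) (b s)) t = b.repr (R (b p) (b q) (b s)) t :=
        hS_eq (p, q, s, t) (congrArg _ (weight_iff.2 hw))
      rw [coeff]
      obtain ⟨⟨⟨rfl, rfl⟩ | ⟨rfl, rfl⟩, rfl⟩, rfl⟩ := hw
      · simp [hpq.symm]
      · rw [(hN hR).1]
        simp [hpq]
    · have coeff : b.repr (S (b p) (b q) (b s)) t = 0 :=
        hS_zero (p, q, s, t) fun h => hw <| weight_iff.1 <|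
          zpow_right_injective₀ two_pos (by norm_num) h
      rw [coeff]
      grind
  rwa [S_eq, Submodule.smul_mem_iff _ h] at hS

theorem projU_ne_bot [FiniteDimensional ℝ V] (hV : 3 ≤ finrank ℝ V) : ProjU V ≠ ⊥ := by
  intro h
  have finrank_eq_zero : finrank ℝ (ProjU V).toSubmodule = 0 := by
    rw [h]
    exact finrank_bot ℝ (OpForm V)
  have hm : (3 : ℝ) ≤ finrank ℝ V := by exact_mod_cast hV
  have dim_factor_pos : (0 : ℝ) < (finrank ℝ V : ℝ) ^ 2 - 4 := by nlinarith
  have := cast_finrank_projU (V := V) (by lia)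
  rw [finrank_eq_zero, Nat.cast_zero] at this
  exact absurd this (by positivity)

theorem isIrreducible_projU [FiniteDimensional ℝ V] (hV : 3 ≤ finrank ℝ V) :
    (ProjU V).toRepresentation.IsIrreducible := by
  have hV₁ : 1 < finrank ℝ V := by lia
  let b := finBasis ℝ V
  let e : Fin 3 ↪ Fin (finrank ℝ V) := Fin.castLEEmb hV
  refine isIrreducible_of_orbit (K := ℝ) (projU_ne_bot hV)
    (wedgeForm (b.coord (e 1)) (b.coord (e 2)) (b (e 0)))
    (fun N hN hN0 => ?_) (coeffPairing (K := ℝ) (E := OpForm V) (opCoeff b))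
    fun S hS hS_orbit => by_contra fun hS0 => ?_
  · have hN_curv : N.toSubmodule ≤ curvSubmodule V := fun _ h => (hN h).2
    obtain ⟨R, hR, hR0⟩ := Submodule.exists_mem_ne_zero_of_ne_bot fun h =>
      hN0 (Subrepresentation.toSubmodule_injective h)
    obtain ⟨c, hc⟩ := exists_basis_coord_apply_ne_zero hV₁ (hN hR) hR0 b e
    have := N.apply_mem_toSubmodule (basisGL c b) <| wedgeForm_mem_of_coord_ne_zero
      hN_curv hR c (e.injective.ne (by decide)) (e.injective.ne (by decide)) hc
    rwa [opRep_wedgeForm, coord_basisGL_inv, coord_basisGL_inv, basisGL_apply] at this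
  · obtain ⟨c, hc⟩ := exists_basis_coord_apply_ne_zero hV₁ hS hS0 b e
    have := hS_orbit (basisGL b (contragredient b c))
    rw [opRep_wedgeForm, coord_basisGL_inv, coord_basisGL_inv, basisGL_apply,
      coord_contragredient, coord_contragredient, coeffPairing_wedgeForm b hS.2,
      toDual_contragredient] at this
    exact hc ((mul_eq_zero.1 this).resolve_left two_ne_zero)

end RicciFlatIrreducible

end AffineCurvature

end

open AffineCurvature Module in
theorem theorem4p1_general {V : Type*} [AddCommGroup V] [Module ℝ V] [FiniteDimensional ℝ V]
    (m : ℕ) (hm : 3 ≤ m) (hV : finrank ℝ V = m) :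
    (∃ (i : (AffF V).toRepresentation.IntertwiningMap (CurvR V).toRepresentation)
        (p : (CurvR V).toRepresentation.IntertwiningMap (Alt2 V).toRepresentation)
        (s : (Alt2 V).toRepresentation.IntertwiningMap (CurvR V).toRepresentation),
      (∀ F, (i F : OpForm V) = F) ∧
      (∀ R, (p R : BilForm V) = piA (rho14 (R : OpForm V))) ∧
      (∀ ω, (s ω : OpForm V) = sigmaA (ω : BilForm V)) ∧
      IsSplitShortExact i p s) ∧
    (∃ (i : (ProjU V).toRepresentation.IntertwiningMap (AffF V).toRepresentation)
        (p : (AffF V).toRepresentation.IntertwiningMap (SymB V).toRepresentation)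
        (s : (SymB V).toRepresentation.IntertwiningMap (AffF V).toRepresentation),
      (∀ U, (i U : OpForm V) = U) ∧
      (∀ F, (p F : BilForm V) = piS (rho14 (F : OpForm V))) ∧
      (∀ ψ, (s ψ : OpForm V) = sigmaS (ψ : BilForm V)) ∧
      IsSplitShortExact i p s) ∧
    (∃ e : ((ProjU V).toRepresentation.prod (SymB V).toRepresentation).Equiv
          (AffF V).toRepresentation,
      ∀ U ψ, (e (U, ψ) : OpForm V) = (U : OpForm V) + sigmaS (ψ : BilForm V)) ∧
    (ProjU V).toRepresentation.IsIrreducible ∧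
    (SymB V).toRepresentation.IsIrreducible ∧
    (finrank ℝ (ProjU V).toSubmodule : ℝ) = (m : ℝ) ^ 2 * ((m : ℝ) ^ 2 - 4) / 3 ∧
    (finrank ℝ (SymB V).toSubmodule : ℝ) = (m : ℝ) * ((m : ℝ) + 1) / 2 ∧
    (finrank ℝ (AffF V).toSubmodule : ℝ) =
      (m : ℝ) * ((m : ℝ) - 1) * (2 * (m : ℝ) ^ 2 + 2 * (m : ℝ) - 3) / 6 := by
  subst hV
  have hV : 1 < finrank ℝ V := by lia
  have : Nontrivial V := finrank_pos_iff.1 (zero_lt_one.trans hV)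
  exact ⟨⟨inclAffCurv V, curvToAlt V, altToCurv V, fun _ => rfl, fun _ => rfl, fun _ => rfl,
      isSplitShortExact_curvToAlt V⟩,
    ⟨inclProjUAff V, affToSym V, symToAff hV, fun _ => rfl, fun _ => rfl, fun _ => rfl,
      isSplitShortExact_affToSym hV⟩,
    ⟨(isSplitShortExact_affToSym hV).equiv, fun _ _ => rfl⟩,
    isIrreducible_projU hm, isIrreducible_symB,
    cast_finrank_projU hV, cast_finrank_sym V, cast_finrank_aff V⟩

theorem theorem4p1 {V : Type*} [AddCommGroup V] [Module ℝ V] [FiniteDimensional ℝ V]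
    (m : ℕ) (hm : 4 ≤ m) (hV : Module.finrank ℝ V = m) :
    -- the first sequence, with inclusion, `π_a ∘ ρ₁₄` and splitting `σ_a`
    (∃ (i : (AffineCurvature.AffF V).toRepresentation.IntertwiningMap
          (AffineCurvature.CurvR V).toRepresentation)
        (p : (AffineCurvature.CurvR V).toRepresentation.IntertwiningMap
          (AffineCurvature.Alt2 V).toRepresentation)
        (s : (AffineCurvature.Alt2 V).toRepresentation.IntertwiningMap
          (AffineCurvature.CurvR V).toRepresentation),
      (∀ F, (i F : AffineCurvature.OpForm V) = F) ∧
      (∀ R, (p R : AffineCurvature.BilForm V) =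
        AffineCurvature.piA (AffineCurvature.rho14 (R : AffineCurvature.OpForm V))) ∧
      (∀ ω, (s ω : AffineCurvature.OpForm V) =
        AffineCurvature.sigmaA (ω : AffineCurvature.BilForm V)) ∧
      AffineCurvature.IsSplitShortExact i p s) ∧
    -- the second sequence, with inclusion, `π_s ∘ ρ₁₄` and splitting `σ_s`
    (∃ (i : (AffineCurvature.ProjU V).toRepresentation.IntertwiningMap
          (AffineCurvature.AffF V).toRepresentation)
        (p : (AffineCurvature.AffF V).toRepresentation.IntertwiningMap
          (AffineCurvature.SymB V).toRepresentation)
        (s : (AffineCurvature.SymB V).toRepresentation.IntertwiningMap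
          (AffineCurvature.AffF V).toRepresentation),
      (∀ U, (i U : AffineCurvature.OpForm V) = U) ∧
      (∀ F, (p F : AffineCurvature.BilForm V) =
        AffineCurvature.piS (AffineCurvature.rho14 (F : AffineCurvature.OpForm V))) ∧
      (∀ ψ, (s ψ : AffineCurvature.OpForm V) =
        AffineCurvature.sigmaS (ψ : AffineCurvature.BilForm V)) ∧
      AffineCurvature.IsSplitShortExact i p s) ∧
    -- the resulting decomposition into irreducible modules
    (∃ e : ((AffineCurvature.ProjU V).toRepresentation.prod
          (AffineCurvature.SymB V).toRepresentation).Equiv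
          (AffineCurvature.AffF V).toRepresentation,
      ∀ U ψ, (e (U, ψ) : AffineCurvature.OpForm V) =
        (U : AffineCurvature.OpForm V) +
          AffineCurvature.sigmaS (ψ : AffineCurvature.BilForm V)) ∧
    (AffineCurvature.ProjU V).toRepresentation.IsIrreducible ∧
    (AffineCurvature.SymB V).toRepresentation.IsIrreducible ∧
    -- the dimensions
    (Module.finrank ℝ (AffineCurvature.ProjU V).toSubmodule : ℝ) =
      (m : ℝ) ^ 2 * ((m : ℝ) ^ 2 - 4) / 3 ∧
    (Module.finrank ℝ (AffineCurvature.SymB V).toSubmodule : ℝ) =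
      (m : ℝ) * ((m : ℝ) + 1) / 2 ∧
    (Module.finrank ℝ (AffineCurvature.AffF V).toSubmodule : ℝ) =
      (m : ℝ) * ((m : ℝ) - 1) * (2 * (m : ℝ) ^ 2 + 2 * (m : ℝ) - 3) / 6 :=
  theorem4p1_general m (by lia) hV
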